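/- Let $m\ge 2$ and $n\ge 1$. For a real tensor $\mathcal T=(t_{i_1\cdots i_m})$ of order $m$ and dimension $n$ (indices in $[n]=\{1,\dots,n\}$), a number $\lambda\in\mathbb C$ is an eigenvalue of $\mathcal T$ if there is $x\in\mathbb C^n\setminus\{0\}$ with $$\sum_{i_2,\dots,i_m=1}^n t_{i i_2\cdots i_m}x_{i_2}\cdots x_{i_m}=\lambda x_i^{m-1}\qquad (i\in[n]).$$ Let $\mathrm{Spec}(\mathcal T)$ be the set of all eigenvalues of $\mathcal T$, let $\rho(\mathcal T)=\max\{|\lambda|:\lambda\in\mathrm{Spec}(\mathcal T)\}$ be its spectral radius, and let $|\mathcal T|=(|t_{i_1\cdots i_m}|)$. Let $\mathcal A=\mathcal D-\mathcal C$ be a symmetric $Z$-tensor of order $m$ and dimension $n$ with nonnegative diagonal, where $\mathcal D$ is a nonzero nonnegative diagonal tensor and $\mathcal C=(c_{i_1\cdots i_m})$ is a nonnegative tensor with zero diagonal entries (symmetric means that the entries are invariant under all permutations of their indices). Suppose that $\mathcal C$ is weakly irreducible, that is, the graph on $[n]$ in which distinct $i,j$ are adjacent if and only if $i$ and $j$ occur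 at two positions of the index tuple of some nonzero entry of $\mathcal C$ is connected. Then $$\rho(\mathcal A)=\rho(|\mathcal A|)\quad\Longleftrightarrow\quad \mathrm{Spec}(\mathcal A)=\mathrm{Spec}(|\mathcal A|).$$ -/

import Mathlib

namespace ZTensor

/-- Real tensors of order `m` and dimension `n`: arrays indexed by `m`-tuples from an `n`-element
set. -/
abbrev Tensor (m n : ℕ) : Type := (Fin m → Fin n) → ℝ

/-- The entries are invariant under every permutation of their indices. -/
def IsSymmetric {m n : ℕ} (T : Tensor m n) : Prop :=
  ∀ (σ : Equiv.Perm (Fin m)) (s : Fin m → Fin n), T (s ∘ σ) = T s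

/-- All entries whose indices are not all equal vanish. -/
def IsDiagonal {m n : ℕ} (T : Tensor m n) : Prop :=
  ∀ s : Fin m → Fin n, (¬ ∃ i, s = fun _ => i) → T s = 0

/-- All diagonal entries `t_{ii...i}` vanish. -/
def HasZeroDiagonal {m n : ℕ} (T : Tensor m n) : Prop :=
  ∀ i : Fin n, T (fun _ => i) = 0

/-- All entries are nonnegative. -/
def IsNonneg {m n : ℕ} (T : Tensor m n) : Prop :=
  ∀ s : Fin m → Fin n, 0 ≤ T s

/-- The absolute tensor `|T|`, entry by entry. -/
def absTensor {m n : ℕ} (T : Tensor m n) : Tensor m n :=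
  fun s => |T s|

/-- For `T` of order `m = k + 1` and a complex vector `x`, the vector `T x^{m-1}`, whose `i`-th
component is `∑_{i₂, ..., i_m} t_{i i₂ ... i_m} x_{i₂} ⋯ x_{i_m}`. -/
noncomputable def applyVec {k n : ℕ} (T : Tensor (k + 1) n) (x : Fin n → ℂ) : Fin n → ℂ :=
  fun i => ∑ s : Fin k → Fin n, (T (Fin.cons i s) : ℂ) * ∏ j, x (s j)

/-- `(μ, x)` is an eigenvalue-eigenvector pair: `x ≠ 0` and `T x^{m-1} = μ x^{[m-1]}`,
where `m = k + 1`. -/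
def IsEigenpair {k n : ℕ} (T : Tensor (k + 1) n) (μ : ℂ) (x : Fin n → ℂ) : Prop :=
  x ≠ 0 ∧ ∀ i, applyVec T x i = μ * x i ^ k

/-- The spectrum: the set of all complex eigenvalues. -/
def Spec {k n : ℕ} (T : Tensor (k + 1) n) : Set ℂ :=
  {μ | ∃ x : Fin n → ℂ, IsEigenpair T μ x}

/-- The spectral radius: the largest modulus of an eigenvalue. (The set of moduli is bounded by the
largest absolute row sum, so that the supremum is never taken over an unbounded set.) -/
noncomputable def spectralRad {k n : ℕ} (T : Tensor (k + 1) n) : ℝ :=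
  sSup ((fun μ : ℂ => ‖μ‖) '' Spec T)

/-- The graph of a tensor on its index set: distinct `i` and `j` are joined when they occur at two
positions of the index tuple of a nonzero entry. -/
def indexGraph {m n : ℕ} (T : Tensor m n) : SimpleGraph (Fin n) where
  Adj i j := i ≠ j ∧ ∃ s : Fin m → Fin n, T s ≠ 0 ∧ ∃ p q : Fin m, p ≠ q ∧ s p = i ∧ s q = j
  symm := by
    constructor
    rintro i j ⟨hij, s, hs, p, q, hpq, hp, hq⟩
    exact ⟨hij.symm, s, hs, q, p, hpq.symm, hq, hp⟩
  loopless := by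
    constructor
    rintro i ⟨h, -⟩
    exact h rfl

/-- A tensor is weakly irreducible when its graph is connected. -/
def IsWeaklyIrreducible {m n : ℕ} (T : Tensor m n) : Prop :=
  (indexGraph T).Connected

end ZTensor

/-!
Let `M` be the maximum of `∑ |t_{i₁ ... i_m}| y_{i₁} ⋯ y_{i_m}` over the vectors `y ≥ 0` with
`∑ y_i ^ m = 1`. Weak irreducibility forces a maximizer to be positive, and by symmetry the
Lagrange condition at a positive maximizer is the eigenvalue equation of `|T|`; hence
`M = ρ(|T|)`. If `T x^{m-1} = μ x^{[m-1]}` with `|μ| = M`, the triangle inequality makes `|x|` a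
maximizer. So `|x|` is a positive eigenvector of `|T|`, and the triangle inequality is an equality
in every row: all terms `t_{i i₂ ... i_m} x_{i₂} ⋯ x_{i_m}` point in the direction of `μ x_i^{m-1}`.
A positive diagonal entry then gives `μ = M`, and the phases of `x` form a diagonal matrix
transforming `T` into `|T|`, which preserves the spectrum.
-/

namespace ZTensor

open Finset

section Generalities

theorem sum_pow_pos {ι R : Type*} [Fintype ι] [Semiring R] [PartialOrder R] [IsStrictOrderedRing R]
    {y : ι → R} (hy : 0 ≤ y) (hy₀ : y ≠ 0) (m : ℕ) : 0 < ∑ i, y i ^ m := by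
  obtain ⟨i, hi⟩ := Function.ne_iff.1 hy₀
  exact sum_pos' (fun l _ => pow_nonneg (hy l) m) ⟨i, mem_univ i, pow_pos ((hy i).lt_of_ne' hi) m⟩

theorem sum_add_smul_pow_of_mul_eq_zero {ι R : Type*} [Fintype ι] [CommSemiring R]
    [NoZeroDivisors R] {y e : ι → R} (h : ∀ i, y i * e i = 0) (t : R) {m : ℕ} (hm : m ≠ 0) :
    ∑ i, (y + t • e) i ^ m = ∑ i, y i ^ m + (∑ i, e i ^ m) * t ^ m := by
  rw [sum_mul, ← sum_add_distrib]
  refine sum_congr rfl fun i _ => ?_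
  rcases mul_eq_zero.1 (h i) with hi | hi <;> simp [hi, hm, mul_pow, mul_comm]

theorem pow_mul_prod_add_le {ι R : Type*} [CommSemiring R] [PartialOrder R] [IsOrderedRing R]
    {k : ℕ} {y e : ι → R} (hy : 0 ≤ y) (he : 0 ≤ e) {t : R} (ht₀ : 0 ≤ t) (ht₁ : t ≤ 1)
    (s : Fin (k + 1) → ι) {q : Fin (k + 1)} (hq : e (s q) = 0) :
    t ^ k * ∏ j, (y + e) (s j) ≤ ∏ j, (y + t • e) (s j) := by
  have hye (l : ι) : 0 ≤ (y + e) l := add_nonneg (hy l) (he l)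
  have hscale (l : ι) : t * (y + e) l ≤ (y + t • e) l := by
    simpa [mul_add] using add_le_add (mul_le_of_le_one_left (hy l) ht₁) (le_refl (t * e l))
  have hcard : t ^ k = ∏ _j ∈ univ.erase q, t := by simp
  rw [← mul_prod_erase univ _ (mem_univ q),
    ← mul_prod_erase univ (fun j => (y + t • e) (s j)) (mem_univ q), mul_left_comm, hcard,
    ← prod_mul_distrib]
  simp only [Pi.add_apply y, Pi.smul_apply, hq, smul_zero, add_zero]
  exact mul_le_mul_of_nonneg_left
    (prod_le_prod (fun j _ => mul_nonneg ht₀ (hye _)) fun j _ => hscale _) (hy _)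

theorem sameRay_sum_of_norm_sum_eq {ι E : Type*} [NormedAddCommGroup E] [NormedSpace ℝ E]
    [StrictConvexSpace ℝ E] {t : Finset ι} {f : ι → E} (h : ‖∑ r ∈ t, f r‖ = ∑ r ∈ t, ‖f r‖)
    {s : ι} (hs : s ∈ t) : SameRay ℝ (f s) (∑ r ∈ t, f r) := by
  classical
  rw [← add_sum_erase t f hs] at h ⊢
  refine SameRay.add_right SameRay.rfl (sameRay_iff_norm_add.2 (le_antisymm (norm_add_le _ _) ?_))
  rw [h, ← add_sum_erase t (fun r => ‖f r‖) hs]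
  gcongr
  exact norm_sum_le _ _

end Generalities

variable {k m n : ℕ}

section AbsTensor

theorem absTensor_nonneg (T : Tensor m n) : IsNonneg (absTensor T) := fun _ => abs_nonneg _

theorem IsNonneg.absTensor_eq {T : Tensor m n} (hT : IsNonneg T) : absTensor T = T :=
  funext fun s => abs_of_nonneg (hT s)

theorem IsSymmetric.absTensor {T : Tensor m n} (hT : IsSymmetric T) :
    IsSymmetric (absTensor T) := fun σ s => congrArg abs (hT σ s)

theorem indexGraph_absTensor (T : Tensor m n) : indexGraph (absTensor T) = indexGraph T := by
  ext i j
  simp [indexGraph, absTensor]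

theorem IsWeaklyIrreducible.absTensor {T : Tensor m n} (hT : IsWeaklyIrreducible T) :
    IsWeaklyIrreducible (absTensor T) := by
  rwa [IsWeaklyIrreducible, indexGraph_absTensor]

end AbsTensor

section Form

/-- The homogeneous form `∑ t_{i₁ ... i_m} y_{i₁} ⋯ y_{i_m}` of a tensor, restricted to real
vectors. -/
noncomputable def form (T : Tensor m n) (y : Fin n → ℝ) : ℝ :=
  ∑ s : Fin m → Fin n, T s * ∏ j, y (s j)

/-- The vector `T y^{m-1}` of a real vector `y`, the real counterpart of `applyVec`. -/
noncomputable def applyReal (T : Tensor (k + 1) n) (y : Fin n → ℝ) (i : Fin n) : ℝ :=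
  ∑ s : Fin k → Fin n, T (Fin.cons i s) * ∏ j, y (s j)

theorem applyVec_ofReal (T : Tensor (k + 1) n) (y : Fin n → ℝ) (i : Fin n) :
    applyVec T (fun l => (y l : ℂ)) i = applyReal T y i := by
  simp [applyVec, applyReal]

theorem norm_applyVec_le (T : Tensor (k + 1) n) (x : Fin n → ℂ) (i : Fin n) :
    ‖applyVec T x i‖ ≤ applyReal (absTensor T) (fun l => ‖x l‖) i :=
  (norm_sum_le _ _).trans_eq (by simp [applyReal, absTensor])

theorem form_eq_sum_mul_applyReal (T : Tensor (k + 1) n) (y : Fin n → ℝ) :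
    form T y = ∑ i, y i * applyReal T y i := by
  simp only [form, applyReal, mul_sum]
  rw [← (Fin.consEquiv fun _ : Fin (k + 1) => Fin n).sum_comp, Fintype.sum_prod_type]
  refine sum_congr rfl fun i _ => sum_congr rfl fun s _ => ?_
  simp only [Fin.consEquiv, Equiv.coe_fn_mk, Fin.prod_univ_succ, Fin.cons_zero, Fin.cons_succ]
  ring

theorem form_smul (T : Tensor m n) (c : ℝ) (y : Fin n → ℝ) :
    form T (c • y) = c ^ m * form T y := by
  simp [form, prod_mul_distrib, mul_sum, mul_left_comm]

theorem form_zero (T : Tensor m n) (hm : m ≠ 0) : form T 0 = 0 := by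
  simp [form, hm]

theorem form_single (T : Tensor m n) (i : Fin n) : form T (Pi.single i 1) = T fun _ => i := by
  rw [form, sum_eq_single fun _ => i]
  · simp
  · intro s _ hs
    obtain ⟨j, hj⟩ := Function.ne_iff.1 hs
    rw [prod_eq_zero (mem_univ j) (Pi.single_eq_of_ne hj 1), mul_zero]
  · simp

theorem continuous_form (T : Tensor m n) : Continuous (form T) := by
  unfold form
  fun_prop

theorem IsNonneg.form_add_le_form_add_smul {T : Tensor (k + 1) n} (hT : IsNonneg T)
    {y e : Fin n → ℝ} (hy : 0 ≤ y) (he : 0 ≤ e) {s : Fin (k + 1) → Fin n} {p q : Fin (k + 1)}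
    (hp : y (s p) = 0) (hq : e (s q) = 0) {t : ℝ} (ht₀ : 0 ≤ t) (ht₁ : t ≤ 1) :
    form T y + T s * (∏ j, (y + e) (s j)) * t ^ k ≤ form T (y + t • e) := by
  have hle (r : Fin (k + 1) → Fin n) :
      T r * ∏ j, y (r j) ≤ T r * ∏ j, (y + t • e) (r j) :=
    mul_le_mul_of_nonneg_left (prod_le_prod (fun j _ => hy _) fun j _ =>
      le_add_of_nonneg_right (mul_nonneg ht₀ (he _))) (hT r)
  have hle_s : T s * (∏ j, (y + e) (s j)) * t ^ k ≤ T s * ∏ j, (y + t • e) (s j) := by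
    rw [mul_assoc, mul_comm _ (t ^ k)]
    exact mul_le_mul_of_nonneg_left (pow_mul_prod_add_le hy he ht₀ ht₁ s hq) (hT s)
  have hzero : T s * ∏ j, y (s j) = 0 := by rw [prod_eq_zero (mem_univ p) hp, mul_zero]
  rw [form, form, ← add_sum_erase univ _ (mem_univ s), hzero, zero_add, add_comm,
    ← add_sum_erase univ (fun r => T r * ∏ j, (y + t • e) (r j)) (mem_univ s)]
  exact add_le_add hle_s (sum_le_sum fun r _ => hle r)

end Form

section Derivative

theorem IsSymmetric.apply_insertNth {T : Tensor (k + 1) n} (hT : IsSymmetric T)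
    (j : Fin (k + 1)) (i : Fin n) (s : Fin k → Fin n) :
    T (j.insertNth i s) = T (Fin.cons i s) := by
  rw [← hT j.cycleRange (Fin.cons i s)]
  congr 1
  funext l
  simp [Fin.cons_apply_cycleRange]

theorem IsSymmetric.sum_mul_prod_erase_mul_single {T : Tensor (k + 1) n} (hT : IsSymmetric T)
    (y : Fin n → ℝ) (i : Fin n) (j : Fin (k + 1)) :
    ∑ s : Fin (k + 1) → Fin n,
      T s * ((∏ l ∈ univ.erase j, y (s l)) * (Pi.single i 1 : Fin n → ℝ) (s j)) =
        applyReal T y i := by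
  have herase : (univ.erase j : Finset (Fin (k + 1))) = univ.map j.succAboveEmb := by
    ext l
    simp [Fin.exists_succAbove_eq_iff]
  rw [← (Fin.insertNthEquiv (fun _ : Fin (k + 1) => Fin n) j).sum_comp, Fintype.sum_prod_type,
    sum_eq_single i]
  · simp [Fin.insertNthEquiv, applyReal, hT.apply_insertNth, herase]
  · intro b _ hb
    simp [hb]
  · simp

theorem IsSymmetric.hasDerivAt_form_update {T : Tensor (k + 1) n} (hT : IsSymmetric T)
    (y : Fin n → ℝ) (i : Fin n) :
    HasDerivAt (fun t : ℝ => form T (Function.update y i t)) ((k + 1 : ℕ) * applyReal T y i)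
      (y i) := by
  have hcoord := hasDerivAt_pi.1 (hasDerivAt_update y i (y i))
  have hprod (s : Fin (k + 1) → Fin n) :
      HasDerivAt (fun t : ℝ => ∏ j, Function.update y i t (s j))
        (∑ j, (∏ l ∈ univ.erase j, y (s l)) * (Pi.single i 1 : Fin n → ℝ) (s j)) (y i) := by
    simpa using HasDerivAt.fun_finsetProd (u := univ) fun j _ => hcoord (s j)
  have hsum : ∑ s : Fin (k + 1) → Fin n,
      T s * ∑ j, (∏ l ∈ univ.erase j, y (s l)) * (Pi.single i 1 : Fin n → ℝ) (s j) =
        (k + 1 : ℕ) * applyReal T y i := by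
    simp_rw [mul_sum]
    rw [sum_comm]
    simp [hT.sum_mul_prod_erase_mul_single]
  exact hsum ▸ HasDerivAt.fun_sum fun s _ => (hprod s).const_mul (T s)

theorem hasDerivAt_sum_update_pow {ι 𝕜 : Type*} [Fintype ι] [DecidableEq ι]
    [NontriviallyNormedField 𝕜] (y : ι → 𝕜) (i : ι) (m : ℕ) :
    HasDerivAt (fun t : 𝕜 => ∑ l, Function.update y i t l ^ m) (m * y i ^ (m - 1)) (y i) := by
  have hcoord := hasDerivAt_pi.1 (hasDerivAt_update y i (y i))
  simpa [Pi.single_apply] using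
    HasDerivAt.fun_sum fun l (_ : l ∈ univ) => (hcoord l).fun_pow m

end Derivative

section Maximizers

/-- `M` bounds the form of `T` on the nonnegative orthant, relative to `∑ y_i ^ m`. -/
def IsFormBound (T : Tensor m n) (M : ℝ) : Prop :=
  ∀ y : Fin n → ℝ, 0 ≤ y → form T y ≤ M * ∑ i, y i ^ m

/-- The quotient of the form of `T` by `∑ y_i ^ m` has maximum `M` on the nonzero vectors of the
nonnegative orthant, and it is attained at `y`. -/
structure IsFormMaximizer (T : Tensor m n) (M : ℝ) (y : Fin n → ℝ) : Prop where
  isFormBound : IsFormBound T M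
  nonneg : 0 ≤ y
  ne_zero : y ≠ 0
  form_eq : form T y = M * ∑ i, y i ^ m

theorem exists_isFormMaximizer [Nonempty (Fin n)] (T : Tensor m n) (hm : m ≠ 0) :
    ∃ M y, IsFormMaximizer T M y := by
  have hsimplex {z : Fin n → ℝ} (hz : z ∈ stdSimplex ℝ (Fin n)) : z ≠ 0 := by
    rintro rfl
    exact zero_ne_one (by simpa only [Pi.zero_apply, sum_const_zero] using hz.2)
  have hcont : ContinuousOn (fun z => form T z / ∑ i, z i ^ m) (stdSimplex ℝ (Fin n)) :=
    (continuous_form T).continuousOn.div (by fun_prop) fun z hz =>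
      (sum_pow_pos hz.1 (hsimplex hz) m).ne'
  obtain ⟨y, hy, hmax⟩ := (isCompact_stdSimplex ℝ (Fin n)).exists_isMaxOn
    ⟨_, single_mem_stdSimplex ℝ (Classical.arbitrary (Fin n))⟩ hcont
  refine ⟨form T y / ∑ i, y i ^ m, y, fun z hz => ?_, hy.1, hsimplex hy,
    (div_mul_cancel₀ _ (sum_pow_pos hy.1 (hsimplex hy) m).ne').symm⟩
  rcases eq_or_ne z 0 with rfl | hz₀
  · simp [form_zero T hm, hm]
  have hsum : 0 < ∑ i, z i := by simpa using sum_pow_pos hz hz₀ 1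
  have hmem : (∑ i, z i)⁻¹ • z ∈ stdSimplex ℝ (Fin n) :=
    ⟨fun i => mul_nonneg (inv_nonneg.2 hsum.le) (hz i), by
      simp [← mul_sum, inv_mul_cancel₀ hsum.ne']⟩
  rw [← div_le_iff₀ (sum_pow_pos hz hz₀ m)]
  simpa [form_smul, mul_pow, ← mul_sum, mul_div_mul_left, hsum.ne'] using hmax hmem

theorem IsFormBound.diagonal_le {T : Tensor m n} {M : ℝ} (h : IsFormBound T M) (hm : m ≠ 0)
    (i : Fin n) : T (fun _ => i) ≤ M := by
  have := h (Pi.single i 1) (Pi.single_nonneg.2 zero_le_one)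
  simpa [form_single, Pi.single_apply, ite_pow, hm] using this

theorem IsWeaklyIrreducible.exists_ne_zero_of_mem_of_notMem {T : Tensor m n}
    (hT : IsWeaklyIrreducible T) {S : Set (Fin n)} {i j : Fin n} (hi : i ∈ S) (hj : j ∉ S) :
    ∃ s p q, T s ≠ 0 ∧ s p ∈ S ∧ s q ∉ S := by
  obtain ⟨w⟩ := hT.preconnected i j
  obtain ⟨d, -, hfst, hsnd⟩ := w.exists_boundary_dart S hi hj
  obtain ⟨-, s, hs, p, q, -, hp, hq⟩ := d.adj
  exact ⟨s, p, q, hs, hp ▸ hfst, hq ▸ hsnd⟩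

/- If `y` had zeros, then some nonzero entry would couple a zero of `y` with a nonzero coordinate,
and raising all zeros of `y` to `t` would increase the form by at least `c t ^ (m - 1)` but
`∑ y_i ^ m` only by a multiple of `t ^ m`. -/
theorem IsFormMaximizer.pos {T : Tensor (k + 1) n} (hT : IsNonneg T)
    (hirr : IsWeaklyIrreducible T) {M : ℝ} {y : Fin n → ℝ} (h : IsFormMaximizer T M y)
    (i : Fin n) : 0 < y i := by
  refine (h.nonneg i).lt_of_ne' fun hi => ?_
  obtain ⟨j, hj⟩ := Function.ne_iff.1 h.ne_zero
  obtain ⟨s, p, q, hs, hp, hq⟩ := hirr.exists_ne_zero_of_mem_of_notMem (S := {l | y l = 0}) hi hj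
  set e : Fin n → ℝ := Set.indicator {l | y l = 0} 1 with he
  have he₀ : 0 ≤ e := Set.indicator_nonneg fun _ _ => zero_le_one
  have hdisj (l : Fin n) : y l * e l = 0 := by by_cases hl : y l = 0 <;> simp [he, hl]
  have hye (l : Fin n) : 0 < (y + e) l := by
    by_cases hl : y l = 0
    · simp [he, hl]
    · exact add_pos_of_pos_of_nonneg ((h.nonneg l).lt_of_ne' hl) (he₀ l)
  set c := T s * ∏ l, (y + e) (s l)
  have hc : 0 < c := mul_pos ((hT s).lt_of_ne' hs) (prod_pos fun l _ => hye _)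
  set N := ∑ l, e l ^ (k + 1)
  have hbound {t : ℝ} (ht₀ : 0 < t) (ht₁ : t ≤ 1) : c ≤ M * N * t := by
    have hlower := hT.form_add_le_form_add_smul h.nonneg he₀ hp
      (Set.indicator_of_notMem hq 1) ht₀.le ht₁
    have hupper := h.isFormBound (y + t • e) (add_nonneg h.nonneg (smul_nonneg ht₀.le he₀))
    rw [sum_add_smul_pow_of_mul_eq_zero hdisj t k.succ_ne_zero, mul_add, ← h.form_eq] at hupper
    have hpow : c * t ^ k ≤ M * N * t * t ^ k :=
      calc c * t ^ k ≤ M * (N * t ^ (k + 1)) := le_of_add_le_add_left (hlower.trans hupper)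
        _ = M * N * t * t ^ k := by ring
    exact le_of_mul_le_mul_right hpow (pow_pos ht₀ k)
  have hlim : Filter.Tendsto (fun t => M * N * t) (nhdsWithin 0 (Set.Ioi 0)) (nhds 0) := by
    simpa using ((continuous_const_mul (M * N)).tendsto 0).mono_left nhdsWithin_le_nhds
  refine hc.not_ge (ge_of_tendsto hlim ?_)
  filter_upwards [Ioc_mem_nhdsGT one_pos] with t ht using hbound ht.1 ht.2

theorem IsFormMaximizer.applyReal_eq_of_pos {T : Tensor (k + 1) n} (hT : IsSymmetric T) {M : ℝ}
    {y : Fin n → ℝ} (h : IsFormMaximizer T M y) {i : Fin n} (hi : 0 < y i) :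
    applyReal T y i = M * y i ^ k := by
  have hderiv := ((hasDerivAt_sum_update_pow y i (k + 1)).const_mul M).sub
    (hT.hasDerivAt_form_update y i)
  have hmin : IsLocalMin (fun t => M * ∑ l, Function.update y i t l ^ (k + 1) -
      form T (Function.update y i t)) (y i) := by
    filter_upwards [lt_mem_nhds hi] with t ht
    have hupdate : 0 ≤ Function.update y i t :=
      le_update_iff.2 ⟨ht.le, fun l _ => h.nonneg l⟩
    simpa [h.form_eq] using h.isFormBound _ hupdate
  have hzero := hmin.hasDerivAt_eq_zero hderiv
  rw [Nat.add_sub_cancel] at hzero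
  have hk : ((k + 1 : ℕ) : ℝ) ≠ 0 := Nat.cast_ne_zero.2 k.succ_ne_zero
  apply mul_left_cancel₀ hk
  linear_combination -hzero

end Maximizers

section Spectrum

theorem IsEigenpair.norm_mul_sum_le_form {T : Tensor (k + 1) n} {μ : ℂ} {x : Fin n → ℂ}
    (h : IsEigenpair T μ x) :
    ‖μ‖ * ∑ i, ‖x i‖ ^ (k + 1) ≤ form (absTensor T) fun l => ‖x l‖ := by
  rw [form_eq_sum_mul_applyReal, mul_sum]
  refine sum_le_sum fun i _ => ?_
  calc ‖μ‖ * ‖x i‖ ^ (k + 1) = ‖x i‖ * ‖applyVec T x i‖ := by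
        rw [h.2 i, norm_mul, norm_pow]; ring
    _ ≤ ‖x i‖ * applyReal (absTensor T) (fun l => ‖x l‖) i :=
        mul_le_mul_of_nonneg_left (norm_applyVec_le T x i) (norm_nonneg _)

theorem norm_comp_ne_zero {ι E : Type*} [NormedAddCommGroup E] {x : ι → E} (hx : x ≠ 0) :
    (fun l => ‖x l‖) ≠ 0 := by
  obtain ⟨i, hi⟩ := Function.ne_iff.1 hx
  exact Function.ne_iff.2 ⟨i, norm_ne_zero_iff.2 hi⟩

theorem IsFormBound.norm_le {T : Tensor (k + 1) n} {M : ℝ} (hM : IsFormBound (absTensor T) M)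
    {μ : ℂ} (hμ : μ ∈ Spec T) : ‖μ‖ ≤ M := by
  obtain ⟨x, hx⟩ := hμ
  exact le_of_mul_le_mul_right (hx.norm_mul_sum_le_form.trans (hM _ fun i => norm_nonneg _))
    (sum_pow_pos (fun i => norm_nonneg _) (norm_comp_ne_zero hx.1) _)

theorem IsEigenpair.isFormMaximizer_norm {T : Tensor (k + 1) n} {μ : ℂ} {x : Fin n → ℂ}
    (h : IsEigenpair T μ x) (hμ : IsFormBound (absTensor T) ‖μ‖) :
    IsFormMaximizer (absTensor T) ‖μ‖ fun l => ‖x l‖ where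
  isFormBound := hμ
  nonneg _ := norm_nonneg _
  ne_zero := norm_comp_ne_zero h.1
  form_eq := le_antisymm (hμ _ fun _ => norm_nonneg _) h.norm_mul_sum_le_form

theorem IsFormMaximizer.isEigenpair {T : Tensor (k + 1) n} (hT : IsNonneg T)
    (hsymm : IsSymmetric T) (hirr : IsWeaklyIrreducible T) {M : ℝ} {y : Fin n → ℝ}
    (h : IsFormMaximizer T M y) : IsEigenpair T M fun l => (y l : ℂ) := by
  refine ⟨fun hy => h.ne_zero (funext fun l => ?_), fun i => ?_⟩
  · simpa using congrFun hy l
  · rw [applyVec_ofReal, h.applyReal_eq_of_pos hsymm (h.pos hT hirr i)]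
    push_cast
    rfl

theorem IsFormMaximizer.spectralRad_eq {T : Tensor (k + 1) n} (hT : IsNonneg T)
    (hsymm : IsSymmetric T) (hirr : IsWeaklyIrreducible T) {M : ℝ} {y : Fin n → ℝ}
    (h : IsFormMaximizer T M y) : spectralRad T = M := by
  obtain ⟨i, -⟩ := Function.ne_iff.1 h.ne_zero
  have hM : 0 ≤ M := (hT _).trans (h.isFormBound.diagonal_le k.succ_ne_zero i)
  refine IsGreatest.csSup_eq ⟨⟨M, ⟨_, h.isEigenpair hT hsymm hirr⟩, by simp [abs_of_nonneg hM]⟩, ?_⟩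
  rintro _ ⟨μ, hμ, rfl⟩
  exact IsFormBound.norm_le (hT.absTensor_eq.symm ▸ h.isFormBound) hμ

/-- `T'` is the diagonal similarity transform `U^{-(m-1)} T U` of `T` by the invertible diagonal
matrix `U = diag(u)`, with the defining identity of the entries cleared of denominators. -/
structure IsDiagonallySimilar (T T' : Tensor (k + 1) n) (u : Fin n → ℂ) : Prop where
  ne_zero : ∀ i, u i ≠ 0
  apply_mul_prod : ∀ i s, (T (Fin.cons i s) : ℂ) * ∏ j, u (s j) = T' (Fin.cons i s) * u i ^ k

theorem IsDiagonallySimilar.symm {T T' : Tensor (k + 1) n} {u : Fin n → ℂ}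
    (h : IsDiagonallySimilar T T' u) : IsDiagonallySimilar T' T u⁻¹ where
  ne_zero i := inv_ne_zero (h.ne_zero i)
  apply_mul_prod i s := by
    have hprod : ∏ j, u (s j) ≠ 0 := prod_ne_zero_iff.2 fun j _ => h.ne_zero _
    have hpow : u i ^ k ≠ 0 := pow_ne_zero _ (h.ne_zero i)
    simp only [Pi.inv_apply, prod_inv_distrib, inv_pow]
    rw [← div_eq_mul_inv, ← div_eq_mul_inv, div_eq_div_iff hprod hpow, h.apply_mul_prod]

theorem IsEigenpair.mul_of_isDiagonallySimilar {T T' : Tensor (k + 1) n} {μ : ℂ}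
    {u x : Fin n → ℂ} (hx : IsEigenpair T' μ x) (h : IsDiagonallySimilar T T' u) :
    IsEigenpair T μ (u * x) := by
  refine ⟨fun h₀ => hx.1 (funext fun i => ?_), fun i => ?_⟩
  · exact (mul_eq_zero.1 (congrFun h₀ i)).resolve_left (h.ne_zero i)
  · calc applyVec T (u * x) i = u i ^ k * applyVec T' x i := by
          simp only [applyVec, Pi.mul_apply, prod_mul_distrib, mul_sum]
          refine sum_congr rfl fun s _ => ?_
          rw [← mul_assoc, h.apply_mul_prod]
          ring
      _ = μ * (u * x) i ^ k := by rw [hx.2, Pi.mul_apply]; ring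

theorem IsDiagonallySimilar.spec_eq {T T' : Tensor (k + 1) n} {u : Fin n → ℂ}
    (h : IsDiagonallySimilar T T' u) : Spec T = Spec T' :=
  Set.Subset.antisymm (fun _ ⟨_, hx⟩ => ⟨_, hx.mul_of_isDiagonallySimilar h.symm⟩)
    fun _ ⟨_, hx⟩ => ⟨_, hx.mul_of_isDiagonallySimilar h⟩

theorem isDiagonallySimilar_const (T : Tensor (k + 1) n) {c : ℂ} (hc : c ≠ 0) :
    IsDiagonallySimilar T T fun _ => c where
  ne_zero _ := hc
  apply_mul_prod i s := by simp

theorem mem_spec_iff_exists_norm_eq_one {T : Tensor (k + 1) n} {μ : ℂ} :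
    μ ∈ Spec T ↔ ∃ x : Fin n → ℂ, ‖x‖ = 1 ∧ ∀ i, applyVec T x i = μ * x i ^ k := by
  constructor
  · rintro ⟨x, hx⟩
    have hnorm : (‖x‖ : ℂ) ≠ 0 := by simpa using hx.1
    exact ⟨_, norm_smul_inv_norm (𝕜 := ℂ) hx.1,
      (hx.mul_of_isDiagonallySimilar (isDiagonallySimilar_const T (inv_ne_zero hnorm))).2⟩
  · rintro ⟨x, hnorm, hx⟩
    exact ⟨x, norm_ne_zero_iff.1 (hnorm ▸ one_ne_zero), hx⟩

theorem isClosed_spec (T : Tensor (k + 1) n) : IsClosed (Spec T) := by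
  have hclosed : IsClosed {p : ℂ × Metric.sphere (0 : Fin n → ℂ) 1 |
      ∀ i, applyVec T p.2 i = p.1 * (p.2 : Fin n → ℂ) i ^ k} := by
    have hcoord (l : Fin n) :
        Continuous fun p : ℂ × Metric.sphere (0 : Fin n → ℂ) 1 => (p.2 : Fin n → ℂ) l :=
      (continuous_apply l).comp (continuous_subtype_val.comp continuous_snd)
    simp only [Set.ofPred_forall, applyVec]
    exact isClosed_iInter fun i => isClosed_eq (by fun_prop) (by fun_prop)
  convert isClosedMap_fst_of_compactSpace _ hclosed
  ext μ
  simp [mem_spec_iff_exists_norm_eq_one]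

theorem isBounded_spec (T : Tensor (k + 1) n) : Bornology.IsBounded (Spec T) := by
  rcases isEmpty_or_nonempty (Fin n) with hn | hn
  · have hempty : Spec T = ∅ :=
      Set.eq_empty_of_forall_notMem fun μ ⟨x, hx⟩ => hx.1 (Subsingleton.elim x 0)
    exact hempty ▸ Bornology.isBounded_empty
  · obtain ⟨M, y, hy⟩ := exists_isFormMaximizer (absTensor T) k.succ_ne_zero
    exact isBounded_iff_forall_norm_le.2 ⟨M, fun μ hμ => hy.isFormBound.norm_le hμ⟩

theorem exists_mem_spec_norm_eq_spectralRad {T : Tensor (k + 1) n} (hT : (Spec T).Nonempty) :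
    ∃ μ ∈ Spec T, ‖μ‖ = spectralRad T :=
  ((Metric.isCompact_of_isClosed_isBounded (isClosed_spec T) (isBounded_spec T)).image
    continuous_norm).sSup_mem (hT.image _)

end Spectrum

section Wielandt

theorem IsEigenpair.norm_mul_apply_mul_prod_phase {T : Tensor (k + 1) n} {μ : ℂ} {x : Fin n → ℂ}
    (h : IsEigenpair T μ x) (hx : ∀ i, x i ≠ 0) {i : Fin n}
    (hi : applyReal (absTensor T) (fun l => ‖x l‖) i = ‖μ‖ * ‖x i‖ ^ k) (s : Fin k → Fin n) :
    ‖μ‖ * (T (Fin.cons i s) * ∏ j, x (s j) / ‖x (s j)‖) =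
      μ * (absTensor T (Fin.cons i s) * (x i / ‖x i‖) ^ k) := by
  set f : (Fin k → Fin n) → ℂ := fun s => T (Fin.cons i s) * ∏ j, x (s j)
  have hsum : ∑ s, f s = μ * x i ^ k := h.2 i
  have hnorm (s : Fin k → Fin n) :
      ‖f s‖ = absTensor T (Fin.cons i s) * ∏ j, ‖x (s j)‖ := by simp [f, absTensor]
  have hray : SameRay ℝ (f s) (∑ r, f r) := by
    refine sameRay_sum_of_norm_sum_eq ?_ (mem_univ s)
    simp only [hsum, hnorm, norm_mul, norm_pow, ← hi]
    rfl
  have hcross := hray.norm_smul_eq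
  rw [hsum, hnorm, norm_mul, norm_pow] at hcross
  simp only [f, Complex.real_smul, Complex.ofReal_mul, Complex.ofReal_prod,
    Complex.ofReal_pow] at hcross
  have hxi : (‖x i‖ : ℂ) ^ k ≠ 0 := pow_ne_zero _ (by simpa using hx i)
  have hxs : ∏ j, (‖x (s j)‖ : ℂ) ≠ 0 := prod_ne_zero_iff.2 fun j _ => by simpa using hx (s j)
  rw [prod_div_distrib, div_pow]
  field_simp
  linear_combination -hcross

theorem cons_const {α : Type*} (a : α) : (Fin.cons a fun _ => a : Fin (k + 1) → α) = fun _ => a :=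
  funext (Fin.cases rfl fun _ => rfl)

theorem IsEigenpair.isDiagonallySimilar_absTensor {T : Tensor (k + 1) n} {μ : ℂ} {x : Fin n → ℂ}
    (h : IsEigenpair T μ x) (hμ : μ ≠ 0) (hx : ∀ i, x i ≠ 0)
    (heq : ∀ i, applyReal (absTensor T) (fun l => ‖x l‖) i = ‖μ‖ * ‖x i‖ ^ k)
    {i₀ : Fin n} (hi₀ : 0 < T fun _ => i₀) :
    IsDiagonallySimilar T (absTensor T) fun i => x i / ‖x i‖ := by
  have hu (i : Fin n) : x i / ‖x i‖ ≠ 0 := div_ne_zero (hx i) (by simpa using hx i)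
  have hμ_eq : (‖μ‖ : ℂ) = μ := by
    have hdiag := h.norm_mul_apply_mul_prod_phase hx (heq i₀) fun _ => i₀
    rw [cons_const, absTensor, abs_of_pos hi₀, prod_const, card_univ, Fintype.card_fin] at hdiag
    have hT : ((T fun _ => i₀ : ℝ) : ℂ) ≠ 0 := Complex.ofReal_ne_zero.2 hi₀.ne'
    exact mul_right_cancel₀ (mul_ne_zero hT (pow_ne_zero k (hu i₀))) hdiag
  refine ⟨hu, fun i s => mul_left_cancel₀ hμ ?_⟩
  simpa only [hμ_eq] using h.norm_mul_apply_mul_prod_phase hx (heq i) s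

end Wielandt

section DiagonalSub

variable {D C : Tensor m n}

theorem IsWeaklyIrreducible.diagonal_sub (hC : IsWeaklyIrreducible C) (hD : IsDiagonal D)
    (hC₀ : HasZeroDiagonal C) : IsWeaklyIrreducible (D - C) := by
  refine SimpleGraph.Connected.mono ?_ hC
  rintro i j ⟨hij, s, hs, hpq⟩
  have hDs : D s = 0 := hD s fun ⟨l, hl⟩ => hs (hl ▸ hC₀ l)
  exact ⟨hij, s, by simpa [hDs] using hs, hpq⟩

theorem IsDiagonal.exists_sub_pos (hD : IsDiagonal D) (hD_nonneg : IsNonneg D) (hD_ne : D ≠ 0)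
    (hC₀ : HasZeroDiagonal C) : ∃ i, 0 < (D - C) fun _ => i := by
  obtain ⟨s, hs⟩ := Function.ne_iff.1 hD_ne
  obtain ⟨i, rfl⟩ := not_imp_comm.1 (hD s) hs
  exact ⟨i, by simpa [hC₀ i] using (hD_nonneg _).lt_of_ne' hs⟩

end DiagonalSub

end ZTensor

open ZTensor in
theorem mainTheorem5_general {k n : ℕ} {T : Tensor (k + 1) n} (hT_symm : IsSymmetric T)
    (hT_irr : IsWeaklyIrreducible T) (hT_diag : ∃ i, 0 < T fun _ => i) :
    spectralRad T = spectralRad (absTensor T) ↔ Spec T = Spec (absTensor T) := by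
  refine ⟨fun h => ?_, fun h => by rw [spectralRad, h, spectralRad]⟩
  obtain ⟨i₀, hi₀⟩ := hT_diag
  have hnonneg := absTensor_nonneg T
  have hirr := hT_irr.absTensor
  have : Nonempty (Fin n) := ⟨i₀⟩
  obtain ⟨M, y, hy⟩ := exists_isFormMaximizer (absTensor T) k.succ_ne_zero
  have hM : 0 < M :=
    (abs_pos_of_pos hi₀).trans_le (hy.isFormBound.diagonal_le k.succ_ne_zero i₀)
  rw [hy.spectralRad_eq hnonneg hT_symm.absTensor hirr] at h
  -- An empty spectrum would have spectral radius `sSup ∅ = 0`.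
  have hne : (Spec T).Nonempty := Set.nonempty_iff_ne_empty.2 fun hempty => by
    simp [spectralRad, hempty, hM.ne] at h
  obtain ⟨μ, ⟨x, hx⟩, hμ⟩ := exists_mem_spec_norm_eq_spectralRad hne
  obtain rfl : ‖μ‖ = M := hμ.trans h
  have hmax := hx.isFormMaximizer_norm hy.isFormBound
  have hpos := hmax.pos hnonneg hirr
  exact (hx.isDiagonallySimilar_absTensor (norm_pos_iff.1 hM) (fun i => norm_pos_iff.1 (hpos i))
    (fun i => hmax.applyReal_eq_of_pos hT_symm.absTensor (hpos i)) hi₀).spec_eq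

theorem mainTheorem5 (k n : ℕ) (hk : 1 ≤ k) (A D C : ZTensor.Tensor (k + 1) n)
    (hA : A = D - C)
    (hD_diag : ZTensor.IsDiagonal D) (hD_nonneg : ZTensor.IsNonneg D) (hD_ne : D ≠ 0)
    (hC_nonneg : ZTensor.IsNonneg C) (hC_diag : ZTensor.HasZeroDiagonal C)
    (hA_symm : ZTensor.IsSymmetric A) (hC_irr : ZTensor.IsWeaklyIrreducible C) :
    ZTensor.spectralRad A = ZTensor.spectralRad (ZTensor.absTensor A) ↔
      ZTensor.Spec A = ZTensor.Spec (ZTensor.absTensor A) := by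
  subst hA
  exact mainTheorem5_general hA_symm (hC_irr.diagonal_sub hD_diag hC_diag)
    (hD_diag.exists_sub_pos hD_nonneg hD_ne hC_diag)
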